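/- Let $G=(V,E)$ be a finite simple undirected graph with at least two connected components. Consider discrete random variables $X_i$, $i\in V$, with arbitrary alphabets $\mathcal X_i$ and with $H(X_i)<\infty$ for all $i$; write $X_S=(X_i)_{i\in S}$. Their joint distribution $P$ *forms a Markov random field (MRF) represented by $G$* if, for all partitions $V=U\sqcup V_1\sqcup V_2$ (parts possibly empty) such that no vertex of $V_1$ is connected to a vertex of $V_2$ in the graph $G\setminus U$ obtained by deleting the vertices in $U$, the vectors $X_{V_1}$ and $X_{V_2}$ are independent conditionally on $X_U$. Let $\tilde X_i$, $i\in V$, be set variables in general position, i.e. subsets of $\Omega_V=\bigcup_{i\in V}\tilde X_i$ for which all $2^{|V|}-1$ atoms $\bigcap_{i\in S}\tilde X_i\setminus\bigcup_{i\notin S}\tilde X_i$ ($\emptyset\ne S\subseteq V$) are nonempty. Let $\mathcal F_V$ be the $\sigma$-field on $\Omega_V$ that they generate, and put $\tilde X_A=\bigcup_{i\in A}\tilde X_i$. The *$I$-Measure* $\mu^*$ of $P$ is the unique signed measure on $\mathcal F_V$ with $$\mu^*\bigl((\tilde X_A\cap\tilde X_B)\setminus\tilde X_C\bigr)=I(X_A;X_B\mid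 X_C)\qquad\text{for all }A,B,C\subseteq V,$$ where $I(X_A;X_A\mid X_C)=H(X_A\mid X_C)$. It is *nonnegative* if $\mu^*(F)\ge 0$ for all $F\in\mathcal F_V$. A *path* is a graph whose vertices can be linearly ordered so that its edges are exactly the pairs of consecutive vertices (a single vertex is a path). A *forest of paths* is a graph with at least two connected components, each of which is a path. **Theorem.** The $I$-Measure $\mu^*$ is nonnegative for every $P$ as above (over all choices of the alphabets) that forms an MRF represented by $G$ if and only if $G$ is a forest of paths. -/

import Mathlib

namespace MRF

open MeasureTheory

/-! ### Shannon's information measures of a discrete random vector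

The joint distribution of discrete random variables `X i`, `i : V`, with alphabets `𝒳 i` is a
`p : PMF (∀ i, 𝒳 i)`. -/

section Information

/-- Shannon entropy (in nats) of a discrete distribution with finite entropy. -/
noncomputable def entropy {α : Type*} (q : PMF α) : ℝ :=
  ∑' a, Real.negMulLog (q a).toReal

/-- The (nonnegative) series defining the entropy converges, i.e. the entropy is finite. -/
def FiniteEntropy {α : Type*} (q : PMF α) : Prop :=
  Summable fun a => Real.negMulLog (q a).toReal

variable {V : Type*} {𝒳 : V → Type*}

/-- The distribution of `X_S = (X i, i ∈ S)`. -/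
noncomputable def marginal (p : PMF (∀ i, 𝒳 i)) (S : Finset V) : PMF (∀ i : S, 𝒳 i) :=
  p.map S.restrict

/-- The joint entropy `H(X_S)`. -/
noncomputable def jointEntropy (p : PMF (∀ i, 𝒳 i)) (S : Finset V) : ℝ :=
  entropy (marginal p S)

variable [DecidableEq V]

/-- The conditional mutual information `I(X_A; X_B | X_C)`. For `A = B` it is the conditional
entropy `H(X_A | X_C)`, and for `C = ∅` it is `I(X_A; X_B)`. -/
noncomputable def condMutualInfo (p : PMF (∀ i, 𝒳 i)) (A B C : Finset V) : ℝ :=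
  jointEntropy p (A ∪ C) + jointEntropy p (B ∪ C) - jointEntropy p (A ∪ B ∪ C) - jointEntropy p C

/-- `X_A` and `X_B` are independent conditioning on `X_C`:
`p(x_A, x_B, x_C) p(x_C) = p(x_A, x_C) p(x_B, x_C)`. -/
def CondIndep (p : PMF (∀ i, 𝒳 i)) (A B C : Finset V) : Prop :=
  ∀ x : ∀ i, 𝒳 i,
    marginal p (A ∪ B ∪ C) ((A ∪ B ∪ C).restrict x) * marginal p C (C.restrict x) =
      marginal p (A ∪ C) ((A ∪ C).restrict x) * marginal p (B ∪ C) ((B ∪ C).restrict x)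

end Information

/-! ### Markov random fields -/

section Markov

variable {V : Type*} [Fintype V] [DecidableEq V] {𝒳 : V → Type*}

/-- `A` and `B` are disconnected in the graph obtained from `G` by removing the vertices in `U`. -/
def Separates (G : SimpleGraph V) (U A B : Finset V) : Prop :=
  ∀ (a b : V) (ha : a ∉ U) (hb : b ∉ U), a ∈ A → b ∈ B →
    ¬ (G.induce {v | v ∉ U}).Reachable ⟨a, ha⟩ ⟨b, hb⟩

/-- The random variables with joint distribution `p` form a Markov random field represented by `G`:
the global Markov property holds. -/
def IsMRF (G : SimpleGraph V) (p : PMF (∀ i, 𝒳 i)) : Prop :=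
  ∀ U A B : Finset V, Disjoint U A → Disjoint U B → Disjoint A B → U ∪ A ∪ B = Finset.univ →
    Separates G U A B → CondIndep p A B U

end Markov

/-! ### Paths and forests of paths -/

section Graphs

/-- The vertices can be linearly ordered so that the edges are exactly the pairs of consecutive
vertices. -/
def IsPathGraph {V : Type*} (G : SimpleGraph V) : Prop :=
  ∃ n : ℕ, Nonempty (G ≃g SimpleGraph.pathGraph n)

/-- At least two components, each of which is a path. -/
def IsForestOfPaths {V : Type*} (G : SimpleGraph V) : Prop :=
  2 ≤ Nat.card G.ConnectedComponent ∧ ∀ C : G.ConnectedComponent, IsPathGraph C.toSimpleGraph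

end Graphs

/-! ### The I-Measure -/

section IMeasure

/-- The universal set of the information diagram of the random variables indexed by `V`, with one
point for each of the `2 ^ |V| - 1` nonempty atoms: the point `S` is the atom in which exactly the
set variables with index in `S` are not complemented. -/
def InfoSpace (V : Type*) : Type _ := {S : Finset V // S.Nonempty}

variable {V : Type*}

/-- The set variable of the random variable with index `i`. -/
def setVar (i : V) : Set (InfoSpace V) := {S | i ∈ S.1}

/-- The union of the set variables with index in `U`. -/
def setVarUnion (U : Finset V) : Set (InfoSpace V) := ⋃ i ∈ U, setVar i

/-- The σ-field generated by the set variables. -/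
instance : MeasurableSpace (InfoSpace V) :=
  MeasurableSpace.generateFrom (Set.range setVar)

variable {𝒳 : V → Type*}

theorem measurableSet_setVarUnion (U : Finset V) : MeasurableSet (setVarUnion U) :=
  Finset.measurableSet_biUnion U fun i _ =>
    MeasurableSpace.measurableSet_generateFrom (Set.mem_range_self i)

theorem generateFrom_compl_setVarUnion : (inferInstance : MeasurableSpace (InfoSpace V)) =
    MeasurableSpace.generateFrom (Set.range fun U : Finset V => (setVarUnion U)ᶜ) := by
  refine le_antisymm (MeasurableSpace.generateFrom_le ?_) (MeasurableSpace.generateFrom_le ?_)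
  · rintro _ ⟨i, rfl⟩
    have h : (setVarUnion {i})ᶜ ∈ Set.range fun U : Finset V => (setVarUnion U)ᶜ :=
      Set.mem_range_self (f := fun U : Finset V => (setVarUnion U)ᶜ) {i}
    have h' := MeasurableSet.compl (MeasurableSpace.measurableSet_generateFrom h)
    rwa [compl_compl, show setVarUnion {i} = setVar i by simp [setVarUnion]] at h'
  · rintro _ ⟨U, rfl⟩
    exact (measurableSet_setVarUnion U).compl

theorem mem_setVarUnion {U : Finset V} {S : InfoSpace V} :
    S ∈ setVarUnion U ↔ ∃ i ∈ U, i ∈ S.1 := by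
  simp [setVarUnion, setVar]

theorem jointEntropy_empty (p : PMF (∀ i, 𝒳 i)) : jointEntropy p ∅ = 0 := by
  have h : ∀ a, marginal p ∅ a = 1 := fun a => by
    have := (marginal p ∅).tsum_coe
    rwa [tsum_eq_single a fun b hb => absurd (Subsingleton.elim b a) hb] at this
  simp [jointEntropy, entropy, h]

variable [DecidableEq V]

/-- `μ` is consistent with all Shannon's information measures:
`μ(X̃_A ∩ X̃_B - X̃_C) = I(X_A; X_B | X_C)`. -/
def IsIMeasure (p : PMF (∀ i, 𝒳 i)) (μ : SignedMeasure (InfoSpace V)) : Prop :=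
  ∀ A B C : Finset V,
    μ ((setVarUnion A ∩ setVarUnion B) \ setVarUnion C) = condMutualInfo p A B C

theorem setVarUnion_union (A B : Finset V) :
    setVarUnion (A ∪ B) = setVarUnion A ∪ setVarUnion B := by
  ext S
  simp only [mem_setVarUnion, Set.mem_union, Finset.mem_union]
  grind

theorem exists_sum_powerset_eq (h : Finset V → ℝ) :
    ∃ w : Finset V → ℝ, ∀ M : Finset V, ∑ S ∈ M.powerset, w S = h M := by
  let w : Finset V → ℝ := WellFounded.fix (C := fun _ => ℝ) Finset.isWellFounded_ssubset.wf
    fun M f => h M - ∑ S ∈ M.ssubsets.attach, f S.1 (Finset.mem_ssubsets.1 S.2)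
  refine ⟨w, fun M => ?_⟩
  have hw : w M = h M - ∑ S ∈ M.ssubsets, w S := by
    conv_lhs => rw [show w M = _ from WellFounded.fix_eq _ _ M]
    rw [← Finset.sum_attach M.ssubsets]
  rw [← Finset.insert_erase (Finset.mem_powerset_self M),
    Finset.sum_insert (Finset.notMem_erase M _), hw]
  simp [Finset.ssubsets]

/-- The measure of a set of the form `X̃_A ∩ X̃_B - X̃_C` through those of unions of set variables. -/
theorem signedMeasure_inter_diff (μ : SignedMeasure (InfoSpace V)) (A B C : Finset V) :
    μ ((setVarUnion A ∩ setVarUnion B) \ setVarUnion C) =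
      μ (setVarUnion (A ∪ C)) + μ (setVarUnion (B ∪ C)) - μ (setVarUnion (A ∪ B ∪ C)) -
        μ (setVarUnion C) := by
  have hA := measurableSet_setVarUnion A
  have hB := measurableSet_setVarUnion B
  have hC := measurableSet_setVarUnion C
  simp only [setVarUnion_union]
  generalize setVarUnion A = a at *
  generalize setVarUnion B = b at *
  generalize setVarUnion C = c at *
  have h1 : μ (a ∪ c) = μ ((a ∩ b) \ c) + (μ ((a \ b) \ c) + μ c) := by
    rw [← VectorMeasure.of_union (by grind) (by measurability) (by measurability),
      ← VectorMeasure.of_union (by grind) (by measurability) (by measurability)]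
    congr 1
    grind
  have h2 : μ (a ∪ b ∪ c) = μ (b ∪ c) + μ ((a \ b) \ c) := by
    rw [← VectorMeasure.of_union (by grind) (by measurability) (by measurability)]
    congr 1
    grind
  linarith

variable [Fintype V]

/-- The I-Measure exists and is unique. -/
theorem existsUnique_isIMeasure (p : PMF (∀ i, 𝒳 i)) : ∃! μ, IsIMeasure p μ := by
  classical
  have : Fintype (InfoSpace V) := inferInstanceAs (Fintype {S : Finset V // S.Nonempty})
  refine existsUnique_of_exists_of_unique ?_ ?_
  · obtain ⟨w, hw⟩ := exists_sum_powerset_eq fun M : Finset V => jointEntropy p Mᶜ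
    let μ : SignedMeasure (InfoSpace V) :=
      ∑ S : InfoSpace V, (-w S.1) • (Measure.dirac S).toSignedMeasure
    have hμ : ∀ U : Finset V, μ (setVarUnion U) = jointEntropy p U := by
      intro U
      have h0 : ∑ S : Finset V, w S = 0 := by
        simpa [jointEntropy_empty] using hw Finset.univ
      have h1 : ∑ S ∈ Uᶜ.powerset, w S = jointEntropy p U := by simpa using hw Uᶜ
      have h2 : μ (setVarUnion U) =
          ∑ S : InfoSpace V, if S ∈ setVarUnion U then -w S.1 else 0 := by
        have : ∀ s : Finset (InfoSpace V),
            (∑ S ∈ s, (-w S.1) • (Measure.dirac S).toSignedMeasure) (setVarUnion U) =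
              ∑ S ∈ s, if S ∈ setVarUnion U then -w S.1 else 0 := by
          intro s
          induction s using Finset.induction_on with
          | empty => simp
          | insert S s hS ih =>
            rw [Finset.sum_insert hS, Finset.sum_insert hS, add_apply, ih]
            congr 1
            rw [smul_apply,
              Measure.toSignedMeasure_apply_measurable (measurableSet_setVarUnion U),
              measureReal_def, Measure.dirac_apply' _ (measurableSet_setVarUnion U)]
            by_cases h : S ∈ setVarUnion U <;> simp [h]
        exact this Finset.univ
      have h3 : (∑ S : InfoSpace V, if S ∈ setVarUnion U then -w S.1 else 0) =
          ∑ S : Finset V, if S ∈ Uᶜ.powerset then 0 else -w S := by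
        have hr : ∀ S : InfoSpace V, (if S ∈ setVarUnion U then -w S.1 else 0) =
            (fun T : Finset V => if T ∈ Uᶜ.powerset then 0 else -w T) S.1 := by
          intro S
          have : S ∈ setVarUnion U ↔ ¬ S.1 ∈ Uᶜ.powerset := by
            simp only [mem_setVarUnion, Finset.mem_powerset, Finset.subset_iff, Finset.mem_compl]
            grind
          by_cases h : S.1 ∈ Uᶜ.powerset <;> simp only [this, h] <;> simp
        rw [Finset.sum_congr rfl fun S _ => hr S]
        have hne : ∀ T ∈ (Finset.univ : Finset (Finset V)),
            T ∉ Finset.univ.filter (fun T : Finset V => T.Nonempty) →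
              (if T ∈ Uᶜ.powerset then 0 else -w T) = 0 := by
          intro T _ hT
          have : T = ∅ := by simpa [Finset.not_nonempty_iff_eq_empty] using hT
          simp [this]
        rw [← Finset.sum_subset (Finset.filter_subset _ _) hne]
        have hmem : ∀ T : Finset V,
            T ∈ Finset.univ.filter (fun T : Finset V => T.Nonempty) ↔ T.Nonempty := by simp
        exact (Finset.sum_subtype (p := fun T : Finset V => T.Nonempty) _ hmem
          (fun T => if T ∈ Uᶜ.powerset then 0 else -w T)).symm
      rw [h2, h3]
      have h4 : ∑ S : Finset V, (if S ∈ Uᶜ.powerset then 0 else -w S) =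
          ∑ S ∈ Uᶜ.powerset, w S - ∑ S : Finset V, w S := by
        have h5 : ∑ S ∈ Uᶜ.powerset, w S = ∑ S : Finset V, if S ∈ Uᶜ.powerset then w S else 0 := by
          rw [Finset.sum_ite_mem, Finset.univ_inter]
        rw [h5, ← Finset.sum_sub_distrib]
        refine Finset.sum_congr rfl fun S _ => ?_
        split_ifs <;> simp
      rw [h4, h0, h1, sub_zero]
    refine ⟨μ, fun A B C => ?_⟩
    rw [signedMeasure_inter_diff, hμ, hμ, hμ, hμ, condMutualInfo]
  · intro μ ν hμ hν
    have hU : ∀ U : Finset V, μ (setVarUnion U) = ν (setVarUnion U) := by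
      intro U
      have h1 := hμ U U ∅
      have h2 := hν U U ∅
      rw [← h2] at h1
      simpa [setVarUnion] using h1
    have huniv : setVarUnion (Finset.univ : Finset V) = Set.univ := by
      ext S
      simp only [mem_setVarUnion, Finset.mem_univ, true_and, Set.mem_univ, iff_true]
      exact S.2
    have htot : μ Set.univ = ν Set.univ := huniv ▸ hU Finset.univ
    have hcompl : ∀ s : Set (InfoSpace V), MeasurableSet s → μ s = ν s → μ sᶜ = ν sᶜ := by
      intro s hs h
      have h1 := VectorMeasure.of_add_of_sdiff (v := μ) hs MeasurableSet.univ (Set.subset_univ s)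
      have h2 := VectorMeasure.of_add_of_sdiff (v := ν) hs MeasurableSet.univ (Set.subset_univ s)
      rw [Set.compl_eq_univ_sdiff]
      linarith
    refine VectorMeasure.ext fun s hs => ?_
    have hpi : IsPiSystem (Set.range fun U : Finset V => (setVarUnion U)ᶜ) := by
      rintro _ ⟨A, rfl⟩ _ ⟨B, rfl⟩ -
      exact ⟨A ∪ B, by simp [setVarUnion_union, Set.compl_union]⟩
    induction s, hs using MeasurableSpace.induction_on_inter generateFrom_compl_setVarUnion hpi with
    | empty => simp
    | basic t ht =>
      obtain ⟨U, rfl⟩ := ht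
      exact hcompl _ (measurableSet_setVarUnion U) (hU U)
    | compl t ht ih => exact hcompl t ht ih
    | iUnion f hd hf ih =>
      rw [VectorMeasure.of_disjoint_iUnion hf hd, VectorMeasure.of_disjoint_iUnion hf hd]
      exact tsum_congr ih

/-- The I-Measure `μ*` of the random variables with joint distribution `p`: the unique signed
measure consistent with all Shannon's information measures. -/
noncomputable def iMeasure (p : PMF (∀ i, 𝒳 i)) : SignedMeasure (InfoSpace V) :=
  (existsUnique_isIMeasure p).choose

theorem isIMeasure_iMeasure (p : PMF (∀ i, 𝒳 i)) : IsIMeasure p (iMeasure p) :=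
  (existsUnique_isIMeasure p).choose_spec.1

end IMeasure

end MRF

namespace MRF

open MeasureTheory
open scoped ENNReal

/-! ### Entropies as expectations over a common sample space. -/

section PushForward

variable {Ω α β : Type*}

/-! The measure `μ*` is determined by its values on the atoms, indexed by the nonempty vertex sets
`S`, and `I(X_A; X_B | X_{Sᶜ})` is the sum of the atoms `T ⊆ S` meeting both `A` and `B`. By
induction on `S`, the Markov property kills every atom whose index set induces a disconnected
subgraph (`IsMRF.iMeasure_atom_eq_zero`).

If `G` is a forest of paths, a connected `S` is an interval of one path, with ends `a` and `b`.
Every proper subset of `S` containing both ends has a gap, so its atom vanishes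
(`IsForestOfPaths.exists_ends`). Hence the atom of `S` equals `I(X_a; X_b | X_{Sᶜ})`, which is
nonnegative by Shannon's inequality (`condMutualInfo_nonneg`).

Conversely, a component that is not a path contains a vertex of degree at least three or a cycle
(`isPathGraph_or_star_or_cycle`). Either one supports a Markov random field built from two
independent fair bits and their sum: `I(X_a; X_b) = 0` while `I(X_a; X_b | X_d) = log 2`, so the
triple intersection has measure `-log 2`. -/

theorem tsum_map_mul (r : PMF Ω) (f : Ω → α) (F : α → ℝ≥0∞) :
    ∑' x, r.map f x * F x = ∑' ω, r ω * F (f ω) := by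
  classical
  simp only [PMF.map_apply, ← ENNReal.tsum_mul_right]
  rw [ENNReal.tsum_comm]
  refine tsum_congr fun ω => ?_
  rw [tsum_eq_single (f ω) (by intro x hx; simp [hx])]
  simp

/-- The probability of the fibre of `f` through `ω` depends only on the partition into fibres. -/
theorem map_apply_congr (r : PMF Ω) {f : Ω → α} {g : Ω → β}
    (h : ∀ ω ω', f ω = f ω' ↔ g ω = g ω') (ω : Ω) : r.map f (f ω) = r.map g (g ω) := by
  classical
  simp only [PMF.map_apply, h]

theorem le_map_apply (r : PMF Ω) (f : Ω → α) (ω : Ω) : r ω ≤ r.map f (f ω) := by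
  classical
  rw [PMF.map_apply]
  refine le_trans ?_ (ENNReal.le_tsum ω)
  simp

theorem negMulLog_toReal_nonneg (r : PMF Ω) (ω : Ω) : 0 ≤ Real.negMulLog (r ω).toReal :=
  Real.negMulLog_nonneg ENNReal.toReal_nonneg
    (ENNReal.toReal_le_of_le_ofReal zero_le_one (by simpa using r.coe_le_one ω))

theorem neg_log_toReal_nonneg (r : PMF Ω) (ω : Ω) : 0 ≤ -Real.log (r ω).toReal := by
  have := Real.log_nonpos (x := (r ω).toReal) ENNReal.toReal_nonneg
    (ENNReal.toReal_le_of_le_ofReal zero_le_one (by simpa using r.coe_le_one ω))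
  linarith

theorem summable_iff_tsum_ofReal_ne_top {f : α → ℝ} (hf : ∀ a, 0 ≤ f a) :
    Summable f ↔ ∑' a, ENNReal.ofReal (f a) ≠ ∞ := by
  refine ⟨Summable.tsum_ofReal_ne_top, fun h => ?_⟩
  simpa [ENNReal.toReal_ofReal (hf _)] using ENNReal.summable_toReal h

/-- In `ℝ≥0∞` no convergence is needed, so this single identity yields both the finiteness criterion
and the value of the entropy. -/
theorem tsum_ofReal_negMulLog_map (r : PMF Ω) (f : Ω → α) :
    ∑' x, ENNReal.ofReal (Real.negMulLog (r.map f x).toReal) =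
      ∑' ω, ENNReal.ofReal ((r ω).toReal * -Real.log (r.map f (f ω)).toReal) := by
  have h := tsum_map_mul r f fun x => ENNReal.ofReal (-Real.log (r.map f x).toReal)
  convert h using 2 with x
  · ext x
    rw [Real.negMulLog, neg_mul_comm, ENNReal.ofReal_mul ENNReal.toReal_nonneg,
      ENNReal.ofReal_toReal ((r.map f).apply_ne_top x)]
  · ext ω
    rw [ENNReal.ofReal_mul ENNReal.toReal_nonneg, ENNReal.ofReal_toReal (r.apply_ne_top ω)]

theorem mul_neg_log_map_nonneg (r : PMF Ω) (f : Ω → α) (ω : Ω) :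
    0 ≤ (r ω).toReal * -Real.log (r.map f (f ω)).toReal :=
  mul_nonneg ENNReal.toReal_nonneg (neg_log_toReal_nonneg _ _)

theorem finiteEntropy_map_iff (r : PMF Ω) (f : Ω → α) :
    FiniteEntropy (r.map f) ↔
      Summable fun ω => (r ω).toReal * -Real.log (r.map f (f ω)).toReal := by
  rw [FiniteEntropy, summable_iff_tsum_ofReal_ne_top (negMulLog_toReal_nonneg _),
    summable_iff_tsum_ofReal_ne_top (mul_neg_log_map_nonneg r f), tsum_ofReal_negMulLog_map]

/-- The entropy of `f` is the expectation of its self-information. -/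
theorem entropy_map (r : PMF Ω) (f : Ω → α) :
    entropy (r.map f) = ∑' ω, (r ω).toReal * -Real.log (r.map f (f ω)).toReal := by
  have h := congrArg ENNReal.toReal (tsum_ofReal_negMulLog_map r f)
  rw [ENNReal.tsum_toReal_eq (by simp), ENNReal.tsum_toReal_eq (by simp)] at h
  simpa only [entropy, ENNReal.toReal_ofReal (negMulLog_toReal_nonneg _ _),
    ENNReal.toReal_ofReal (mul_neg_log_map_nonneg r f _)] using h

theorem entropy_map_congr (r : PMF Ω) {f : Ω → α} {g : Ω → β}
    (h : ∀ ω ω', f ω = f ω' ↔ g ω = g ω') : entropy (r.map f) = entropy (r.map g) := by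
  simp only [entropy_map, map_apply_congr r h]

theorem tsum_map_prodMk_left {γ : Type*} (r : PMF Ω) (f : Ω → α) (h : Ω → γ) (c : γ) :
    ∑' a, r.map (fun ω => (f ω, h ω)) (a, c) = r.map h c := by
  classical
  simp only [PMF.map_apply, Prod.mk.injEq]
  rw [ENNReal.tsum_comm]
  refine tsum_congr fun ω => ?_
  rw [tsum_eq_single (f ω) (by intro x hx; simp [hx])]
  simp

/-- This replaces Jensen's inequality: cancelling the joint probability leaves at most `∑ p(a,c)
p(b,c) / p(c)`, and summing over `a` and `b` gives at most `∑ p(c) = 1`. -/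
theorem tsum_mul_map_ratio_le_one {γ : Type*} (r : PMF Ω) (f : Ω → α) (g : Ω → β) (h : Ω → γ) :
    ∑' ω, r ω * (r.map (fun ω => (f ω, h ω)) (f ω, h ω) * r.map (fun ω => (g ω, h ω)) (g ω, h ω) /
      (r.map (fun ω => (f ω, g ω, h ω)) (f ω, g ω, h ω) * r.map h (h ω))) ≤ 1 := by
  set P := r.map (fun ω => (f ω, g ω, h ω)) with hP
  set Q := r.map (fun ω => (f ω, h ω)) with hQ
  set R := r.map (fun ω => (g ω, h ω)) with hR
  set T := r.map h with hT
  have h1 := tsum_map_mul r (fun ω => (f ω, g ω, h ω))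
    fun x => Q (x.1, x.2.2) * R (x.2.1, x.2.2) / (P x * T x.2.2)
  rw [← h1, ← hP]
  calc ∑' x : α × β × γ, P x * (Q (x.1, x.2.2) * R (x.2.1, x.2.2) / (P x * T x.2.2))
      ≤ ∑' x : α × β × γ, Q (x.1, x.2.2) * R (x.2.1, x.2.2) * (T x.2.2)⁻¹ := by
        refine ENNReal.tsum_le_tsum fun x => ?_
        by_cases hx : P x = 0
        · simp [hx]
        · rw [div_eq_mul_inv, ENNReal.mul_inv (Or.inl hx) (Or.inl (P.apply_ne_top x))]
          calc _ = (P x * (P x)⁻¹) * (Q (x.1, x.2.2) * R (x.2.1, x.2.2) * (T x.2.2)⁻¹) := by ring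
            _ ≤ _ := by
              rw [ENNReal.mul_inv_cancel hx (P.apply_ne_top x), one_mul]
    _ = ∑' c, (∑' a, Q (a, c)) * (∑' b, R (b, c)) * (T c)⁻¹ := by
        rw [ENNReal.tsum_prod']
        simp only [ENNReal.tsum_prod']
        simp only [← ENNReal.tsum_mul_right, ← ENNReal.tsum_mul_left]
        have : ∀ a : α, ∑' (b : β) (c : γ), Q (a, c) * R (b, c) * (T c)⁻¹ =
            ∑' (c : γ) (b : β), Q (a, c) * R (b, c) * (T c)⁻¹ := fun a => ENNReal.tsum_comm
        simp only [this]
        rw [ENNReal.tsum_comm]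
        refine tsum_congr fun c => ENNReal.tsum_comm
    _ ≤ ∑' c, T c := by
        -- Only an inequality holds in general form, since `T c * (T c)⁻¹` is `0` when `T c = 0`.
        refine ENNReal.tsum_le_tsum fun c => ?_
        rw [hQ, hR, tsum_map_prodMk_left, tsum_map_prodMk_left, ← hT, mul_assoc]
        exact mul_le_of_le_one_right' (ENNReal.mul_inv_le_one _)
    _ = 1 := T.tsum_coe

theorem hasSum_toReal (p : PMF Ω) : HasSum (fun ω => (p ω).toReal) 1 := by
  have h := ENNReal.hasSum_toReal (f := p) (by simp [p.tsum_coe])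
  rwa [← ENNReal.tsum_toReal_eq p.apply_ne_top, p.tsum_coe, ENNReal.toReal_one] at h

end PushForward

/-! ### Shannon's inequality and vanishing under conditional independence. -/

section Shannon

variable {V : Type*} {𝒳 : V → Type*}

/-- The probability that `X_S` takes the value it has at `ω`. -/
noncomputable def margProb (p : PMF (∀ i, 𝒳 i)) (S : Finset V) (ω : ∀ i, 𝒳 i) : ℝ≥0∞ :=
  marginal p S (S.restrict ω)

theorem margProb_toReal_pos {p : PMF (∀ i, 𝒳 i)} {ω : ∀ i, 𝒳 i} (h : p ω ≠ 0) (S : Finset V) :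
    0 < (margProb p S ω).toReal :=
  ENNReal.toReal_pos (fun h0 => h (le_antisymm (h0 ▸ le_map_apply p S.restrict ω) zero_le))
    (PMF.apply_ne_top _ _)

theorem margProb_empty (p : PMF (∀ i, 𝒳 i)) (ω : ∀ i, 𝒳 i) : margProb p ∅ ω = 1 := by
  have := (marginal p ∅).tsum_coe
  rwa [tsum_eq_single (Finset.restrict ∅ ω) fun b hb => absurd (Subsingleton.elim b _) hb] at this

variable [DecidableEq V]

theorem restrict_union_eq_iff (A B : Finset V) (ω ω' : ∀ i, 𝒳 i) :
    (A ∪ B).restrict ω = (A ∪ B).restrict ω' ↔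
      A.restrict ω = A.restrict ω' ∧ B.restrict ω = B.restrict ω' := by
  simp only [funext_iff, Finset.restrict, Subtype.forall, Finset.mem_union]
  grind

theorem tsum_mul_margProb_ratio_le_one (p : PMF (∀ i, 𝒳 i)) (A B C : Finset V) :
    ∑' ω, p ω * (margProb p (A ∪ C) ω * margProb p (B ∪ C) ω /
      (margProb p (A ∪ B ∪ C) ω * margProb p C ω)) ≤ 1 := by
  refine le_of_eq_of_le (tsum_congr fun ω => ?_)
    (tsum_mul_map_ratio_le_one p A.restrict B.restrict C.restrict)
  have h1 : ∀ A : Finset V, margProb p (A ∪ C) ω =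
      p.map (fun ω => (A.restrict ω, C.restrict ω)) (A.restrict ω, C.restrict ω) := fun A =>
    map_apply_congr p (g := fun ω => (A.restrict ω, C.restrict ω))
      (by simp [restrict_union_eq_iff]) ω
  have h2 : margProb p (A ∪ B ∪ C) ω =
      p.map (fun ω => (A.restrict ω, B.restrict ω, C.restrict ω))
        (A.restrict ω, B.restrict ω, C.restrict ω) :=
    map_apply_congr p (g := fun ω => (A.restrict ω, B.restrict ω, C.restrict ω))
      (by simp [restrict_union_eq_iff, and_assoc]) ω
  rw [h1, h1, h2]
  rfl

/-- The integrand whose expectation is `I(X_A; X_B | X_C)` dominates `1 - ratio`. -/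
theorem one_sub_ratio_le {p : PMF (∀ i, 𝒳 i)} {ω : ∀ i, 𝒳 i} (A B C : Finset V) :
    (p ω).toReal - (p ω * (margProb p (A ∪ C) ω * margProb p (B ∪ C) ω /
      (margProb p (A ∪ B ∪ C) ω * margProb p C ω))).toReal ≤
    (p ω).toReal * -Real.log (margProb p (A ∪ C) ω).toReal +
      (p ω).toReal * -Real.log (margProb p (B ∪ C) ω).toReal -
      (p ω).toReal * -Real.log (margProb p (A ∪ B ∪ C) ω).toReal -
      (p ω).toReal * -Real.log (margProb p C ω).toReal := by
  by_cases h : p ω = 0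
  · simp [h]
  have h1 := margProb_toReal_pos h (A ∪ C)
  have h2 := margProb_toReal_pos h (B ∪ C)
  have h3 := margProb_toReal_pos h (A ∪ B ∪ C)
  have h4 := margProb_toReal_pos h C
  rw [ENNReal.toReal_mul, ENNReal.toReal_div, ENNReal.toReal_mul, ENNReal.toReal_mul]
  generalize (margProb p (A ∪ C) ω).toReal = x at *
  generalize (margProb p (B ∪ C) ω).toReal = y at *
  generalize (margProb p (A ∪ B ∪ C) ω).toReal = z at *
  generalize (margProb p C ω).toReal = t at *
  have h5 := Real.log_le_sub_one_of_pos (show 0 < x * y / (z * t) by positivity)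
  rw [Real.log_div (by positivity) (by positivity), Real.log_mul h1.ne' h2.ne',
    Real.log_mul h3.ne' h4.ne'] at h5
  nlinarith [mul_le_mul_of_nonneg_left h5 (ENNReal.toReal_nonneg (a := p ω))]

theorem summable_ratio (p : PMF (∀ i, 𝒳 i)) (A B C : Finset V) :
    Summable fun ω => (p ω * (margProb p (A ∪ C) ω * margProb p (B ∪ C) ω /
      (margProb p (A ∪ B ∪ C) ω * margProb p C ω))).toReal :=
  ENNReal.summable_toReal
    (ne_top_of_le_ne_top ENNReal.one_ne_top (tsum_mul_margProb_ratio_le_one p A B C))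

theorem tsum_ratio_toReal_le_one (p : PMF (∀ i, 𝒳 i)) (A B C : Finset V) :
    ∑' ω, (p ω * (margProb p (A ∪ C) ω * margProb p (B ∪ C) ω /
      (margProb p (A ∪ B ∪ C) ω * margProb p C ω))).toReal ≤ 1 := by
  have h := tsum_mul_margProb_ratio_le_one p A B C
  rw [← ENNReal.tsum_toReal_eq
    (ENNReal.ne_top_of_tsum_ne_top (ne_top_of_le_ne_top ENNReal.one_ne_top h))]
  exact ENNReal.toReal_le_of_le_ofReal zero_le_one (by simpa using h)

/-- Finite marginal entropies force finite joint entropies. Self-information is not pointwise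
subadditive, but by `one_sub_ratio_le` with `C = ∅` it is so up to the summable error `ratio - p`.
-/
theorem summable_selfInfo {p : PMF (∀ i, 𝒳 i)}
    (hp : ∀ i, FiniteEntropy (p.map fun x => x i)) (S : Finset V) :
    Summable fun ω => (p ω).toReal * -Real.log (margProb p S ω).toReal := by
  induction S using Finset.induction_on with
  | empty => simp [margProb_empty]
  | insert i S hi ih =>
    have hi : Summable fun ω => (p ω).toReal * -Real.log (margProb p {i} ω).toReal := by
      convert (finiteEntropy_map_iff p _).1 (hp i) using 6 with ω
      exact map_apply_congr p (g := fun x => x i) (by simp [funext_iff, Finset.restrict]) ω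
    refine Summable.of_nonneg_of_le (fun ω => mul_neg_log_map_nonneg p _ ω) (fun ω => ?_)
      ((hi.add ih).add ((summable_ratio p {i} S ∅).sub (hasSum_toReal p).summable))
    have h := one_sub_ratio_le (p := p) (ω := ω) {i} S ∅
    simp only [Finset.union_empty, margProb_empty, ← Finset.insert_eq] at h ⊢
    change (p ω).toReal * -Real.log (margProb p (insert i S) ω).toReal ≤ _
    simp only [ENNReal.toReal_one, Real.log_one, neg_zero, mul_zero, sub_zero] at h
    linarith

theorem hasSum_condMutualInfo {p : PMF (∀ i, 𝒳 i)}
    (hp : ∀ i, FiniteEntropy (p.map fun x => x i)) (A B C : Finset V) :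
    HasSum (fun ω => (p ω).toReal * -Real.log (margProb p (A ∪ C) ω).toReal +
      (p ω).toReal * -Real.log (margProb p (B ∪ C) ω).toReal -
      (p ω).toReal * -Real.log (margProb p (A ∪ B ∪ C) ω).toReal -
      (p ω).toReal * -Real.log (margProb p C ω).toReal) (condMutualInfo p A B C) := by
  have h : ∀ S : Finset V, HasSum (fun ω => (p ω).toReal * -Real.log (margProb p S ω).toReal)
      (jointEntropy p S) := fun S => by
    rw [jointEntropy, marginal, entropy_map]
    exact (summable_selfInfo hp S).hasSum
  exact (((h _).add (h _)).sub (h _)).sub (h _)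

/-- Summing `one_sub_ratio_le` bounds the information below by one minus the expected ratio, which
is at most one. -/
theorem condMutualInfo_nonneg {p : PMF (∀ i, 𝒳 i)}
    (hp : ∀ i, FiniteEntropy (p.map fun x => x i)) (A B C : Finset V) :
    0 ≤ condMutualInfo p A B C := by
  have h := hasSum_le (fun ω => one_sub_ratio_le (p := p) (ω := ω) A B C)
    ((hasSum_toReal p).sub (summable_ratio p A B C).hasSum) (hasSum_condMutualInfo hp A B C)
  linarith [tsum_ratio_toReal_le_one p A B C]

theorem CondIndep.condMutualInfo_eq_zero {p : PMF (∀ i, 𝒳 i)} {A B C : Finset V}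
    (h : CondIndep p A B C) (hp : ∀ i, FiniteEntropy (p.map fun x => x i)) :
    condMutualInfo p A B C = 0 := by
  refine (hasSum_condMutualInfo hp A B C).unique ?_
  -- The integrand vanishes pointwise: it is `p ω` times the logarithm of the factorization
  -- identity.
  convert hasSum_zero with ω
  by_cases h0 : p ω = 0
  · simp [h0]
  have h1 := margProb_toReal_pos h0 (A ∪ C)
  have h2 := margProb_toReal_pos h0 (B ∪ C)
  have h3 := margProb_toReal_pos h0 (A ∪ B ∪ C)
  have h4 := margProb_toReal_pos h0 C
  have h5 : margProb p (A ∪ B ∪ C) ω * margProb p C ω =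
      margProb p (A ∪ C) ω * margProb p (B ∪ C) ω := h ω
  have h6 := congrArg (fun x => Real.log x.toReal) h5
  simp only [ENNReal.toReal_mul] at h6
  rw [Real.log_mul h3.ne' h4.ne', Real.log_mul h1.ne' h2.ne'] at h6
  linear_combination (p ω).toReal * h6

end Shannon

/-! ### Atoms of the information diagram. -/

section Atoms

variable {V : Type*}

/-- The atom in which exactly the set variables with index in `T` are not complemented; it is
empty for `T = ∅`. -/
def atom (T : Finset V) : Set (InfoSpace V) := {S | S.1 = T}

variable [Fintype V]

theorem measurableSet_atom (T : Finset V) : MeasurableSet (atom T) := by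
  classical
  have h : atom T = ⋂ i, if i ∈ T then setVar i else (setVar i)ᶜ := by
    ext S
    simp only [atom, Set.mem_ofPred_eq, Set.mem_iInter, Finset.ext_iff]
    refine forall_congr' fun i => ?_
    by_cases hi : i ∈ T <;> simp [hi, setVar]
  rw [h]
  refine MeasurableSet.iInter fun i => ?_
  have := MeasurableSpace.measurableSet_generateFrom (Set.mem_range_self (f := setVar) i)
  split_ifs
  exacts [this, MeasurableSet.compl this]

theorem signedMeasure_eq_sum_atom (μ : SignedMeasure (InfoSpace V)) (F : Finset (Finset V)) :
    μ {S | S.1 ∈ F} = ∑ T ∈ F, μ (atom T) := by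
  rw [← VectorMeasure.of_biUnion_finset _ fun T _ => measurableSet_atom T]
  · congr 1
    ext S
    simp [atom]
  · intro T _ T' _ hne
    refine Set.disjoint_left.2 fun S hS hS' => hne ?_
    exact hS.symm.trans hS'

/-- A signed measure on the information diagram is nonnegative if all atoms are. -/
theorem nonneg_of_atom_nonneg {μ : SignedMeasure (InfoSpace V)}
    (h : ∀ T : Finset V, T.Nonempty → 0 ≤ μ (atom T)) : 0 ≤ μ := by
  classical
  intro s _
  have hs : s = {S | S.1 ∈ Finset.univ.filter
      fun T => ∃ hT : T.Nonempty, (⟨T, hT⟩ : InfoSpace V) ∈ s} := by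
    ext S
    simp only [Finset.mem_filter, Finset.mem_univ, true_and, Set.mem_ofPred_eq]
    exact ⟨fun hS => ⟨S.2, hS⟩, fun ⟨_, hS⟩ => hS⟩
  change (0 : ℝ) ≤ μ s
  rw [hs, signedMeasure_eq_sum_atom]
  refine Finset.sum_nonneg fun T hT => ?_
  obtain ⟨-, hT, -⟩ := Finset.mem_filter.1 hT
  exact h T hT

variable [DecidableEq V] {𝒳 : V → Type*}

/-- Conditioning on the complement of `S` keeps only atoms indexed inside `S`, which suits induction
on `S`. -/
theorem condMutualInfo_eq_sum_atom (p : PMF (∀ i, 𝒳 i)) (A B S : Finset V) :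
    condMutualInfo p A B Sᶜ = ∑ T ∈ S.powerset with (A ∩ T).Nonempty ∧ (B ∩ T).Nonempty,
      iMeasure p (atom T) := by
  rw [← isIMeasure_iMeasure p A B Sᶜ, ← signedMeasure_eq_sum_atom]
  congr 1
  ext T
  simp only [Set.mem_sdiff, Set.mem_inter_iff, mem_setVarUnion, Finset.mem_compl,
    Finset.mem_filter, Finset.mem_powerset, Finset.Nonempty, Finset.mem_inter, Set.mem_ofPred_eq,
    Finset.subset_iff]
  grind

end Atoms

/-! ### Disconnected index sets, and nonnegativity on forests of paths. -/

section Split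

variable {V : Type*} [DecidableEq V]

/-- The subgraph induced by `T` is disconnected: `T` splits into two nonempty parts without edges
between them. -/
def Splits (G : SimpleGraph V) (T : Finset V) : Prop :=
  ∃ A B : Finset V, A.Nonempty ∧ B.Nonempty ∧ Disjoint A B ∧ A ∪ B = T ∧
    ∀ a ∈ A, ∀ b ∈ B, ¬ G.Adj a b

variable [Fintype V] {𝒳 : V → Type*}

theorem separates_of_not_adj {G : SimpleGraph V} {A B : Finset V} (hd : Disjoint A B)
    (h : ∀ a ∈ A, ∀ b ∈ B, ¬ G.Adj a b) : Separates G (A ∪ B)ᶜ A B := by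
  intro a b ha hb haA hbB hr
  have key : ∀ x y : {v | v ∉ (A ∪ B)ᶜ}, (G.induce {v | v ∉ (A ∪ B)ᶜ}).Reachable x y →
      x.1 ∈ A → y.1 ∈ A := by
    rintro x y ⟨w⟩
    induction w with
    | nil => exact id
    | @cons u v w huv _ ih =>
      intro hu
      refine ih ?_
      have hv : v.1 ∈ A ∪ B := not_not.1 (Finset.mem_compl.not.1 v.2)
      rcases Finset.mem_union.1 hv with hv | hv
      · exact hv
      · exact absurd huv (h _ hu _ hv)
  exact Finset.disjoint_left.1 hd (key _ _ hr haA) hbB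

/-- The I-Measure of a Markov random field vanishes on the atoms whose indices induce a disconnected
subgraph. -/
theorem IsMRF.iMeasure_atom_eq_zero {G : SimpleGraph V} {p : PMF (∀ i, 𝒳 i)}
    (hp : ∀ i, FiniteEntropy (p.map fun x => x i)) (h : IsMRF G p) (S : Finset V)
    (hS : Splits G S) : iMeasure p (atom S) = 0 := by
  induction S using Finset.strongInduction with
  | H S ih =>
    obtain ⟨A, B, hA, hB, hd, rfl, hadj⟩ := hS
    have hci : CondIndep p A B (A ∪ B)ᶜ := by
      refine h _ A B ?_ ?_ hd ?_ (separates_of_not_adj hd hadj)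
      · exact Finset.disjoint_left.2 (by simp; grind)
      · exact Finset.disjoint_left.2 (by simp)
      · rw [Finset.union_assoc, Finset.union_comm, Finset.union_compl]
    have h0 := hci.condMutualInfo_eq_zero hp
    -- Every other atom `T` in the sum meets both `A` and `B`, hence is split by `A ∩ T` and `B ∩ T`
    -- and vanishes by induction.
    rw [condMutualInfo_eq_sum_atom, Finset.sum_eq_single (A ∪ B)] at h0
    · exact h0
    · intro T hT hne
      simp only [Finset.mem_filter, Finset.mem_powerset] at hT
      refine ih T (hT.1.ssubset_of_ne hne) ⟨A ∩ T, B ∩ T, hT.2.1, hT.2.2, ?_, ?_, ?_⟩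
      · exact hd.mono Finset.inter_subset_left Finset.inter_subset_left
      · rw [← Finset.union_inter_distrib_right, Finset.inter_eq_right.2 hT.1]
      · exact fun a ha b hb => hadj a (Finset.mem_inter.1 ha).1 b (Finset.mem_inter.1 hb).1
    · intro hn
      refine absurd ?_ hn
      simp only [Finset.mem_filter, Finset.mem_powerset, Finset.Subset.refl, true_and]
      exact ⟨by rwa [Finset.inter_eq_left.2 Finset.subset_union_left],
        by rwa [Finset.inter_eq_left.2 Finset.subset_union_right]⟩

/-- In a forest of paths a nonsplitting set of vertices has two ends, at least one of which is
missing from every smaller set that does not split. -/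
theorem IsForestOfPaths.exists_ends {G : SimpleGraph V} (hG : IsForestOfPaths G) {S : Finset V}
    (hne : S.Nonempty) (hS : ¬ Splits G S) :
    ∃ a ∈ S, ∃ b ∈ S, ∀ T ⊂ S, a ∈ T → b ∈ T → Splits G T := by
  classical
  obtain ⟨v, hv⟩ := hne
  obtain ⟨n, ⟨φ⟩⟩ := hG.2 (G.connectedComponentMk v)
  -- Otherwise the component of `v` and its complement would split `S`.
  have hSC : ∀ u ∈ S, u ∈ G.connectedComponentMk v := by
    by_contra! hcon
    obtain ⟨u, hu, hu'⟩ := hcon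
    refine hS ⟨S.filter (· ∈ G.connectedComponentMk v), S.filter (· ∉ G.connectedComponentMk v),
      ⟨v, Finset.mem_filter.2
        ⟨hv, SimpleGraph.ConnectedComponent.connectedComponentMk_mem⟩⟩, ⟨u, by simp [hu, hu']⟩,
      Finset.disjoint_filter_filter_not _ _ _,
      Finset.filter_union_filter_not_eq _ _, ?_⟩
    intro a ha b hb hab
    rw [Finset.mem_filter] at ha hb
    exact hb.2 ((SimpleGraph.ConnectedComponent.mem_supp_congr_adj _ hab).1 ha.2)
  -- Position along the path; the default `0` is never taken on `S`.
  let pos : V → ℕ := fun u => if hu : u ∈ G.connectedComponentMk v then φ ⟨u, hu⟩ else 0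
  have hpos : ∀ u (hu : u ∈ S), pos u = φ ⟨u, hSC u hu⟩ := fun u hu => by simp [pos, hSC u hu]
  have hinj : ∀ u ∈ S, ∀ w ∈ S, pos u = pos w → u = w := by
    intro u hu w hw h
    rw [hpos u hu, hpos w hw] at h
    simpa using φ.injective (Fin.ext h)
  have hadj : ∀ u ∈ S, ∀ w ∈ S, G.Adj u w → pos u + 1 = pos w ∨ pos w + 1 = pos u := by
    intro u hu w hw h
    rw [hpos u hu, hpos w hw]
    refine SimpleGraph.pathGraph_adj.1 (φ.map_adj_iff.2 ?_)
    exact (SimpleGraph.ConnectedComponent.toSimpleGraph_adj _ (hSC u hu) (hSC w hw)).2 h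
  obtain ⟨a, ha, hamin⟩ := S.exists_min_image pos ⟨v, hv⟩
  obtain ⟨b, hb, hbmax⟩ := S.exists_max_image pos ⟨v, hv⟩
  refine ⟨a, ha, b, hb, fun T hT haT hbT => ?_⟩
  -- A vertex `s` missing from `T` lies strictly between the ends; adjacent vertices have
  -- consecutive positions, so no edge of `T` jumps over `s`.
  obtain ⟨s, hs, hsT⟩ := Finset.exists_of_ssubset hT
  have hTS := hT.subset
  have hsne : ∀ t ∈ T, pos t ≠ pos s := fun t ht h => hsT (hinj t (hTS ht) s hs h ▸ ht)
  refine ⟨T.filter (pos · < pos s), T.filter (¬ pos · < pos s), ⟨a, ?_⟩, ⟨b, ?_⟩,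
    Finset.disjoint_filter_filter_not _ _ _, Finset.filter_union_filter_not_eq _ _, ?_⟩
  · exact Finset.mem_filter.2 ⟨haT, lt_of_le_of_ne (hamin s hs) (hsne a haT)⟩
  · exact Finset.mem_filter.2 ⟨hbT, not_lt.2 (hbmax s hs)⟩
  · intro x hx y hy hxy
    rw [Finset.mem_filter] at hx hy
    have := hadj x (hTS hx.1) y (hTS hy.1) hxy
    have := hsne y hy.1
    omega

theorem singleton_inter_nonempty_iff {V : Type*} [DecidableEq V] {a : V} {T : Finset V} :
    ({a} ∩ T).Nonempty ↔ a ∈ T := by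
  simp [Finset.Nonempty]

/-- For nonsplitting `S` with ends `a`, `b`, all terms of `I(X_a; X_b | X_{Sᶜ})` except the atom of
`S` vanish. -/
theorem IsForestOfPaths.iMeasure_nonneg {G : SimpleGraph V} (hG : IsForestOfPaths G)
    {p : PMF (∀ i, 𝒳 i)} (hp : ∀ i, FiniteEntropy (p.map fun x => x i)) (h : IsMRF G p) :
    0 ≤ iMeasure p := by
  refine nonneg_of_atom_nonneg fun S hne => ?_
  by_cases hS : Splits G S
  · exact (h.iMeasure_atom_eq_zero hp S hS).ge
  obtain ⟨a, ha, b, hb, hab⟩ := hG.exists_ends hne hS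
  have h0 := condMutualInfo_nonneg hp {a} {b} Sᶜ
  rwa [condMutualInfo_eq_sum_atom, Finset.sum_eq_single S] at h0
  · intro T hT hTS
    simp only [Finset.mem_filter, Finset.mem_powerset, singleton_inter_nonempty_iff] at hT
    exact h.iMeasure_atom_eq_zero hp T (hab T (hT.1.ssubset_of_ne hTS) hT.2.1 hT.2.2)
  · intro hn
    simp [ha, hb, singleton_inter_nonempty_iff] at hn

end Split

/-! ### Connected graphs that are not paths. -/

section PathRecognition

variable {W : Type*}

/-- Either a connected finite graph is a path, or it has a vertex of degree at least three, or
it contains a cycle `f 0, …, f n`. -/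
theorem isPathGraph_or_star_or_cycle [Finite W] {H : SimpleGraph W} (hH : H.Connected) :
    IsPathGraph H ∨
      (∃ c a b d, H.Adj c a ∧ H.Adj c b ∧ H.Adj c d ∧ a ≠ b ∧ a ≠ d ∧ b ≠ d) ∨
      ∃ (n : ℕ) (f : ℕ → W), 2 ≤ n ∧ (∀ i ≤ n, ∀ j ≤ n, f i = f j → i = j) ∧
        (∀ i < n, H.Adj (f i) (f (i + 1))) ∧ H.Adj (f 0) (f n) := by
  classical
  by_contra! hcon
  obtain ⟨hpath, hstar, hcycle⟩ := hcon
  have := Fintype.ofFinite W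
  let P : ℕ → Prop := fun n => ∃ f : ℕ → W, (∀ i ≤ n, ∀ j ≤ n, f i = f j → i = j) ∧
    ∀ i < n, H.Adj (f i) (f (i + 1))
  have hbound : ∀ n, P n → n ≤ Fintype.card W := by
    rintro n ⟨f, hf, -⟩
    have := Fintype.card_le_of_injective (fun i : Fin (n + 1) => f i) fun i j h =>
      Fin.ext (hf i (by omega) j (by omega) h)
    rw [Fintype.card_fin] at this
    omega
  obtain ⟨v⟩ := hH.nonempty
  have hP0 : P 0 := ⟨fun _ => v, by intro i hi j hj _; omega, by intro i hi; omega⟩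
  -- A longest path, with `n` edges and vertices `f 0, …, f n`.
  obtain ⟨n, ⟨f, hinj, hadj⟩, hmax⟩ : ∃ n, P n ∧ ∀ m, P m → m ≤ n :=
    ⟨Nat.findGreatest P (Fintype.card W), Nat.findGreatest_spec (Nat.zero_le _) hP0,
      fun m hm => Nat.le_findGreatest (hbound m hm) hm⟩
  -- The only neighbours of a path vertex are its neighbours along the path. Any other would give an
  -- inner vertex degree three; at an end it would close a cycle or lengthen the path.
  have hnb : ∀ i ≤ n, ∀ w, H.Adj (f i) w → ∃ j ≤ n, w = f j ∧ (i + 1 = j ∨ j + 1 = i) := by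
    intro i hi w hw
    by_cases hmid : 0 < i ∧ i < n
    · have h1 : H.Adj (f i) (f (i - 1)) := by
        have := hadj (i - 1) (by omega)
        rw [Nat.sub_add_cancel hmid.1] at this
        exact this.symm
      have h2 := hadj i hmid.2
      by_cases e1 : w = f (i - 1)
      · exact ⟨i - 1, by omega, e1, by omega⟩
      by_cases e2 : w = f (i + 1)
      · exact ⟨i + 1, by omega, e2, by omega⟩
      refine absurd (hstar (f i) _ _ _ h1 h2 hw ?_ (Ne.symm e1)) (Ne.symm e2)
      intro h
      have := hinj _ (by omega) _ (by omega) h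
      omega
    have hend : i = 0 ∨ i = n := by omega
    by_cases hr : ∃ j ≤ n, w = f j
    · obtain ⟨j, hj, rfl⟩ := hr
      refine ⟨j, hj, rfl, ?_⟩
      by_contra hne
      have hij : i ≠ j := by rintro rfl; exact H.loopless.irrefl _ hw
      rcases hend with rfl | rfl
      · exact hcycle j f (by omega) (fun k hk l hl => hinj k (by omega) l (by omega))
          (fun k hk => hadj k (by omega)) hw
      · refine hcycle (i - j) (fun k => f (j + k)) (by omega) (fun k hk l hl h => ?_)
          (fun k hk => hadj (j + k) (by omega)) ?_
        · have := hinj (j + k) (by omega) (j + l) (by omega) h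
          omega
        · simpa [Nat.add_sub_cancel' hj] using hw.symm
    · push Not at hr
      exfalso
      have hP : P (n + 1) := by
        rcases hend with rfl | rfl
        · refine ⟨fun k => if k = 0 then w else f (k - 1), ?_, ?_⟩
          · intro k hk l hl h
            by_cases k0 : k = 0 <;> by_cases l0 : l = 0 <;>
              simp only [k0, l0, if_true, if_false] at h
            · omega
            · exact absurd h (hr _ (by omega))
            · exact absurd h.symm (hr _ (by omega))
            · have := hinj _ (by omega) _ (by omega) h
              omega
          · intro k hk
            by_cases k0 : k = 0
            · simpa [k0] using hw.symm
            · have := hadj (k - 1) (by omega)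
              rw [Nat.sub_add_cancel (by omega)] at this
              simpa [k0] using this
        · refine ⟨fun k => if k ≤ i then f k else w, ?_, ?_⟩
          · intro k hk l hl h
            by_cases k0 : k ≤ i <;> by_cases l0 : l ≤ i <;>
              simp only [k0, l0, if_true, if_false] at h
            · exact hinj _ k0 _ l0 h
            · exact absurd h.symm (hr _ k0)
            · exact absurd h (hr _ l0)
            · omega
          · intro k hk
            by_cases k0 : k = i
            · simpa [k0] using hw
            · have h1 : k ≤ i := by omega
              have h2 : k + 1 ≤ i := by omega
              simpa [h1, h2] using hadj k (by omega)
      have := hmax _ hP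
      omega
  -- The path is closed under adjacency, so by connectedness it exhausts the graph.
  have hsurj : ∀ w, ∃ j ≤ n, w = f j := by
    have key : ∀ u w, H.Reachable u w → (∃ j ≤ n, u = f j) → ∃ j ≤ n, w = f j := by
      rintro u w ⟨q⟩
      induction q with
      | nil => exact id
      | cons huv _ ih =>
        rintro ⟨j, hj, rfl⟩
        obtain ⟨k, hk, hk', -⟩ := hnb j hj _ huv
        exact ih ⟨k, hk, hk'⟩
    exact fun w => key (f 0) w (hH.preconnected _ _) ⟨0, by omega, rfl⟩
  let e : Fin (n + 1) ≃ W := Equiv.ofBijective (fun i => f i)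
    ⟨fun i j h => Fin.ext (hinj i (by omega) j (by omega) h), fun w => by
      obtain ⟨j, hj, rfl⟩ := hsurj w
      exact ⟨⟨j, by omega⟩, rfl⟩⟩
  refine hpath ⟨n + 1, ⟨RelIso.symm ⟨e, ?_⟩⟩⟩
  intro i j
  change H.Adj (f i) (f j) ↔ _
  rw [SimpleGraph.pathGraph_adj]
  constructor
  · intro h
    obtain ⟨k, hk, hk', h'⟩ := hnb i (by omega) _ h
    rwa [hinj j (by omega) k hk hk']
  · rintro (h | h)
    · have := hadj i (by omega)
      rwa [h] at this
    · have := hadj j (by omega)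
      rw [h] at this
      exact this.symm

end PathRecognition

/-! ### Markov random fields from functional dependence. -/

section Determined

variable {Ω V : Type*} {𝒳 : V → Type*}

/-- The vector `X_B` is a function of `X_C`. -/
def Determines (X : Ω → ∀ i, 𝒳 i) (C B : Finset V) : Prop :=
  ∀ ω ω', (∀ i ∈ C, X ω i = X ω' i) → ∀ i ∈ B, X ω i = X ω' i

theorem marginal_map_apply (r : PMF Ω) (X : Ω → ∀ i, 𝒳 i) (S : Finset V) (x : ∀ i, 𝒳 i)
    [DecidablePred fun ω => ∀ i ∈ S, X ω i = x i] :
    marginal (r.map X) S (S.restrict x) = ∑' ω, if ∀ i ∈ S, X ω i = x i then r ω else 0 := by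
  rw [marginal, PMF.map_comp, PMF.map_apply]
  refine tsum_congr fun ω => ?_
  have h : S.restrict x = (S.restrict ∘ X) ω ↔ ∀ i ∈ S, X ω i = x i := by
    simp only [funext_iff, Finset.restrict, Subtype.forall, Function.comp]
    exact forall₂_congr fun _ _ => eq_comm
  simp only [h]

theorem Separates.symm {G : SimpleGraph V} {U A B : Finset V} (h : Separates G U A B) :
    Separates G U B A := fun a b ha hb haB hbA hr => h b a hb ha hbA haB hr.symm

variable [DecidableEq V]

theorem CondIndep.symm {p : PMF (∀ i, 𝒳 i)} {A B C : Finset V} (h : CondIndep p A B C) :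
    CondIndep p B A C := by
  intro x
  rw [Finset.union_comm B A, h x, mul_comm]

/-- If `(x_B, x_C)` is attained, fixing `X_C` already fixes `X_B`, so `p(x_A, x_B, x_C) = p(x_A,
x_C)` and `p(x_C) = p(x_B, x_C)`. Otherwise both sides are zero. -/
theorem Determines.condIndep {X : Ω → ∀ i, 𝒳 i} {B C : Finset V} (h : Determines X C B)
    (r : PMF Ω) (A : Finset V) : CondIndep (r.map X) A B C := by
  classical
  intro x
  simp only [marginal_map_apply]
  by_cases hx : ∃ ω, ∀ i ∈ B ∪ C, X ω i = x i
  · obtain ⟨ω₀, h₀⟩ := hx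
    have hB : ∀ ω, (∀ i ∈ C, X ω i = x i) → ∀ i ∈ B, X ω i = x i := fun ω hω i hi =>
      (h ω ω₀ (fun j hj => (hω j hj).trans (h₀ j (Finset.mem_union_right _ hj)).symm) i hi).trans
        (h₀ i (Finset.mem_union_left _ hi))
    congr 1
    · refine tsum_congr fun ω => if_congr ?_ rfl rfl
      have := hB ω
      simp only [Finset.mem_union]
      grind
    · refine tsum_congr fun ω => if_congr ?_ rfl rfl
      have := hB ω
      simp only [Finset.mem_union]
      grind
  · push Not at hx
    have h1 : ∀ ω, ¬ ∀ i ∈ B ∪ C, X ω i = x i := fun ω hω => by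
      obtain ⟨i, hi, hne⟩ := hx ω
      exact hne (hω i hi)
    have h2 : ∀ ω, ¬ ∀ i ∈ A ∪ B ∪ C, X ω i = x i := fun ω hω =>
      h1 ω fun i hi => hω i (by rw [Finset.union_assoc]; exact Finset.mem_union_right _ hi)
    simp only [h1, h2, if_false, tsum_zero, zero_mul, mul_zero]

variable [Fintype V]

theorem Separates.mem_of_adj {G : SimpleGraph V} {U A B : Finset V} (h : Separates G U A B)
    (hUA : Disjoint U A) (hcover : U ∪ A ∪ B = Finset.univ) {x y : V} (hx : x ∈ A)
    (hxy : G.Adj x y) (hy : y ∉ U) : y ∈ A := by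
  by_contra hyA
  have hyB : y ∈ B := by
    have : y ∈ U ∪ A ∪ B := hcover ▸ Finset.mem_univ y
    simp only [Finset.mem_union] at this
    tauto
  have hxU : x ∉ U := Finset.disjoint_right.1 hUA hx
  refine h x y hxU hy hx hyB (SimpleGraph.Adj.reachable ?_)
  simpa using hxy

/-- If the vector on one of the sides of any separation is a function of that on the separating
set, the random variables form a Markov random field. -/
theorem isMRF_map_of_determines {G : SimpleGraph V} (r : PMF Ω) {X : Ω → ∀ i, 𝒳 i}
    (P : Finset V → Finset V → Finset V → Prop)
    (hP : ∀ U A B : Finset V, Disjoint U A → Disjoint U B → Disjoint A B →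
      U ∪ A ∪ B = Finset.univ → (∀ x ∈ A, ∀ y ∉ U, G.Adj x y → y ∈ A) →
      (∀ x ∈ B, ∀ y ∉ U, G.Adj x y → y ∈ B) → P U A B ∨ P U B A)
    (h : ∀ U A B : Finset V, Disjoint U A → Disjoint U B → Disjoint A B →
      (∀ x ∈ A, ∀ y ∉ U, G.Adj x y → y ∈ A) → P U A B → Determines X U B) :
    IsMRF G (r.map X) := by
  intro U A B hUA hUB hAB hcover hsep
  have hcover' : U ∪ B ∪ A = Finset.univ := by rw [← hcover]; grind
  have hA : ∀ x ∈ A, ∀ y ∉ U, G.Adj x y → y ∈ A := fun x hx y hy hxy =>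
    hsep.mem_of_adj hUA hcover hx hxy hy
  have hB : ∀ x ∈ B, ∀ y ∉ U, G.Adj x y → y ∈ B := fun x hx y hy hxy =>
    hsep.symm.mem_of_adj hUB hcover' hx hxy hy
  -- `P` only selects which of the two sides is the determined one; conditional independence is
  -- symmetric.
  rcases hP U A B hUA hUB hAB hcover hA hB with h1 | h1
  · exact (h U A B hUA hUB hAB hA h1).condIndep r A
  · exact ((h U B A hUB hUA hAB.symm hB h1).condIndep r B).symm

end Determined

/-! ### Counterexamples from two fair bits and their sum. -/

section Xor

universe u

variable {V : Type*}

/-- Random variables that are functions of two independent fair bits. -/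
noncomputable def bitsLaw (g : V → Bool × Bool → Bool × Bool) :
    PMF (V → ULift.{u} (Bool × Bool)) :=
  (PMF.uniformOfFintype (Bool × Bool)).map fun ω v => ULift.up (g v ω)

theorem finiteEntropy_bitsLaw (g : V → Bool × Bool → Bool × Bool) (i : V) :
    FiniteEntropy ((bitsLaw g).map fun x => x i) :=
  Summable.of_finite

theorem entropy_map_uniform_bits (f : Bool × Bool → Bool × Bool) (k : ℕ)
    (hk : ∀ ω, (Finset.univ.filter fun ω' => f ω = f ω').card = k) :
    entropy ((PMF.uniformOfFintype (Bool × Bool)).map f) = -Real.log (k / 4) := by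
  have h : ∀ ω, ((PMF.uniformOfFintype (Bool × Bool)).map f (f ω)).toReal = k / 4 := by
    intro ω
    have hsum : (PMF.uniformOfFintype (Bool × Bool)).map f (f ω) =
        ∑ ω' with f ω = f ω', (4 : ENNReal)⁻¹ := by
      rw [PMF.map_apply, tsum_fintype, Finset.sum_filter]
      refine Finset.sum_congr rfl fun ω' _ => ?_
      by_cases h : f ω = f ω'
      · simp only [h, if_true, PMF.uniformOfFintype_apply]
        norm_num
      · simp only [h, if_false]
    rw [hsum, Finset.sum_const, hk]
    simp [div_eq_mul_inv]
  simp only [entropy_map, h, tsum_fintype]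
  simp

theorem jointEntropy_bitsLaw (g : V → Bool × Bool → Bool × Bool) (S : Finset V)
    (f : Bool × Bool → Bool × Bool) (k : ℕ)
    (hk : ∀ ω, (Finset.univ.filter fun ω' => f ω = f ω').card = k)
    (hf : ∀ ω ω', (∀ i ∈ S, g i ω = g i ω') ↔ f ω = f ω') :
    jointEntropy (bitsLaw g) S = -Real.log (k / 4) := by
  rw [jointEntropy, marginal, bitsLaw, PMF.map_comp, ← entropy_map_uniform_bits f k hk]
  refine entropy_map_congr _ fun ω ω' => ?_
  rw [← hf]
  simp [funext_iff, Finset.restrict]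

variable [Fintype V] [DecidableEq V]

/-- Two independent fair bits and their sum have a negative `I`-Measure. -/
theorem not_iMeasure_bitsLaw_nonneg {g : V → Bool × Bool → Bool × Bool} {a b d : V}
    (ha : g a = fun ω => (ω.1, false)) (hb : g b = fun ω => (ω.2, false))
    (hd : g d = fun ω => (xor ω.1 ω.2, false)) : ¬ 0 ≤ iMeasure (bitsLaw.{u, _} g) := by
  have single : ∀ v (f : Bool × Bool → Bool × Bool), g v = f →
      (∀ ω, (Finset.univ.filter fun ω' => f ω = f ω').card = 2) →
      jointEntropy (bitsLaw.{u, _} g) {v} = -Real.log ((2 : ℕ) / 4) := fun v f hv hf =>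
    jointEntropy_bitsLaw g {v} f 2 hf fun ω ω' => by
      rw [← hv]
      simp only [Finset.mem_singleton, forall_eq]
  have full : ∀ S : Finset V, (∀ ω ω', (∀ i ∈ S, g i ω = g i ω') → ω = ω') →
      jointEntropy (bitsLaw.{u, _} g) S = -Real.log ((1 : ℕ) / 4) := fun S hS =>
    jointEntropy_bitsLaw g _ id 1 (by decide)
      fun ω ω' => ⟨hS ω ω', fun h => by rw [show ω = ω' from h]; simp⟩
  have e1 := single a _ ha (by decide)
  have e2 := single b _ hb (by decide)
  have e3 := single d _ hd (by decide)
  have e4 := full ({a} ∪ {b}) (by simp [ha, hb])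
  have e5 := full ({a} ∪ {d}) (by simp [ha, hd])
  have e6 := full ({b} ∪ {d}) (by simp [hb, hd])
  have e7 := full ({a} ∪ {b} ∪ {d}) (by simp [ha, hb, hd])
  have i1 := isIMeasure_iMeasure (bitsLaw.{u, _} g) {a} {b} ∅
  have i2 := isIMeasure_iMeasure (bitsLaw.{u, _} g) {a} {b} {d}
  simp only [condMutualInfo, Finset.union_empty, jointEntropy_empty, e1, e2, e3, e4, e5, e6, e7]
    at i1 i2
  rw [show setVarUnion (∅ : Finset V) = ∅ by simp [setVarUnion], Set.sdiff_empty] at i1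
  intro h
  have hm := (measurableSet_setVarUnion ({a} : Finset V)).inter (measurableSet_setVarUnion {b})
  have hd := measurableSet_setVarUnion ({d} : Finset V)
  -- Splitting `X̃_a ∩ X̃_b` along `X̃_d` reads `0 = log 2 + μ*(X̃_a ∩ X̃_b ∩ X̃_d)`.
  have hadd := VectorMeasure.of_union (v := iMeasure (bitsLaw.{u, _} g))
    (Set.disjoint_sdiff_inter (s := setVarUnion {a} ∩ setVarUnion {b}) (t := setVarUnion {d}))
    (hm.diff hd) (hm.inter hd)
  rw [Set.sdiff_union_inter, i1, i2] at hadd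
  have hpos : 0 ≤ iMeasure (bitsLaw.{u, _} g)
      (setVarUnion {a} ∩ setVarUnion {b} ∩ setVarUnion {d}) :=
    h _ (hm.inter hd)
  have hlog : Real.log ((2 : ℕ) / 4) = -Real.log 2 := by
    rw [← Real.log_inv]
    norm_num
  have hlog' : Real.log ((1 : ℕ) / 4) = -(2 * Real.log 2) := by
    rw [← Real.log_rpow two_pos, ← Real.log_inv]
    norm_num
  rw [hlog, hlog'] at hadd
  have := Real.log_pos one_lt_two
  linarith

/-- A vertex of degree at least three admits a Markov random field with a negative `I`-Measure. -/
theorem exists_isMRF_of_star {G : SimpleGraph V} {c a b d : V} (hca : G.Adj c a)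
    (hcb : G.Adj c b) (hcd : G.Adj c d) (hab : a ≠ b) (had : a ≠ d) (hbd : b ≠ d) :
    ∃ g : V → Bool × Bool → Bool × Bool, IsMRF G (bitsLaw.{u, _} g) ∧
      ¬ 0 ≤ iMeasure (bitsLaw.{u, _} g) := by
  -- The centre `c` carries both bits, three neighbours carry the bits and their sum, and all other
  -- variables are constant.
  let g : V → Bool × Bool → Bool × Bool := fun v =>
    if v = c then id else if v = a then fun ω => (ω.1, false)
    else if v = b then fun ω => (ω.2, false)
    else if v = d then fun ω => (xor ω.1 ω.2, false) else fun _ => (false, false)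
  refine ⟨g, ?_, not_iMeasure_bitsLaw_nonneg (a := a) (b := b) (d := d) ?_ ?_ ?_⟩
  · refine isMRF_map_of_determines _ (fun U A _ => c ∈ U ∨ c ∈ A) ?_ ?_
    · intro U A B _ _ _ hcover _ _
      have : c ∈ U ∪ A ∪ B := hcover ▸ Finset.mem_univ c
      simp only [Finset.mem_union] at this
      tauto
    -- If `c ∈ U`, both bits are known. If `c ∈ A`, its neighbours lie in `U ∪ A`, so only constants
    -- remain in `B`.
    · rintro U A B hUA hUB hAB hA (hc | hc) ω ω' hU i hi
      · have : ω = ω' := by simpa [g] using hU c hc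
        rw [this]
      · have hn : ∀ v, v = c ∨ G.Adj c v → i ≠ v := by
          rintro v hv rfl
          rcases hv with rfl | hv
          · exact Finset.disjoint_left.1 hAB hc hi
          · exact Finset.disjoint_left.1 hAB
              (hA c hc i (Finset.disjoint_right.1 hUB hi) hv) hi
        simp [g, hn c (.inl rfl), hn a (.inr hca), hn b (.inr hcb), hn d (.inr hcd)]
  · simp [g, hca.ne']
  · simp [g, hcb.ne', hab.symm]
  · simp [g, hcd.ne', had.symm, hbd.symm]

/-- A cycle admits a Markov random field with a negative `I`-Measure. -/
theorem exists_isMRF_of_cycle {G : SimpleGraph V} {n : ℕ} {f : ℕ → V} (hn : 2 ≤ n)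
    (hinj : ∀ i ≤ n, ∀ j ≤ n, f i = f j → i = j) (hadj : ∀ i < n, G.Adj (f i) (f (i + 1)))
    (hclose : G.Adj (f 0) (f n)) :
    ∃ g : V → Bool × Bool → Bool × Bool, IsMRF G (bitsLaw.{u, _} g) ∧
      ¬ 0 ≤ iMeasure (bitsLaw.{u, _} g) := by
  classical
  -- The adjacent vertices `f 0` and `f n` carry the bits, and all the vertices between them along
  -- the cycle carry the same sum. The cycle need not be induced.
  let g : V → Bool × Bool → Bool × Bool := fun v =>
    if v = f 0 then fun ω => (ω.1, false) else if v = f n then fun ω => (ω.2, false)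
    else if ∃ i, 0 < i ∧ i < n ∧ v = f i then fun ω => (xor ω.1 ω.2, false)
    else fun _ => (false, false)
  have g0 : g (f 0) = fun ω => (ω.1, false) := by simp [g]
  have gn : g (f n) = fun ω => (ω.2, false) := by simp [g, hclose.ne']
  have gm : ∀ i, 0 < i → i < n → g (f i) = fun ω => (xor ω.1 ω.2, false) := by
    intro i h0 h1
    have e0 : f i ≠ f 0 := fun h => by have := hinj i h1.le 0 (by omega) h; omega
    have e1 : f i ≠ f n := fun h => by have := hinj i h1.le n le_rfl h; omega
    have e2 : ∃ j, 0 < j ∧ j < n ∧ f i = f j := ⟨i, h0, h1, rfl⟩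
    simp only [g, e0, e1, e2, if_true, if_false]
  refine ⟨g, ?_, not_iMeasure_bitsLaw_nonneg g0 gn (gm 1 (by omega) (by omega))⟩
  -- Since `f 0` and `f n` are adjacent, they cannot lie on opposite sides; `A` denotes a side such
  -- that neither is in `B`.
  refine isMRF_map_of_determines _ (fun U A _ => (f 0 ∈ U ∨ f 0 ∈ A) ∧ (f n ∈ U ∨ f n ∈ A)) ?_ ?_
  · intro U A B _ _ _ hcover hA hB
    have h0 : f 0 ∈ U ∪ A ∪ B := hcover ▸ Finset.mem_univ _
    have h1 : f n ∈ U ∪ A ∪ B := hcover ▸ Finset.mem_univ _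
    simp only [Finset.mem_union] at h0 h1
    have h2 := fun h h' => hA (f 0) h (f n) h' hclose
    have h3 := fun h h' => hB (f 0) h (f n) h' hclose
    tauto
  · rintro U A B hUA hUB hAB hA ⟨h0, h1⟩ ω ω' hU i hi
    have hne : ∀ v, v ∈ U ∨ v ∈ A → i ≠ v := by
      rintro v (hv | hv) rfl
      · exact Finset.disjoint_left.1 hUB hv hi
      · exact Finset.disjoint_left.1 hAB hv hi
    -- An intermediate vertex in `U` reveals the sum, the only nonconstant value possible in `B`.
    by_cases hmid : ∃ j, 0 < j ∧ j < n ∧ f j ∈ U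
    · obtain ⟨j, j0, jn, hj⟩ := hmid
      have hj := hU _ hj
      simp only [gm j j0 jn] at hj
      simp only [g, hne _ h0, hne _ h1, if_false]
      split_ifs
      · exact hj
      · rfl
    push Not at hmid
    by_cases hA' : ∀ j, 0 < j → j < n → f j ∈ A
    · have h2 : ¬ ∃ j, 0 < j ∧ j < n ∧ i = f j := by
        rintro ⟨j, j0, jn, h⟩
        exact hne _ (.inr (hA' j j0 jn)) h
      simp only [g, hne _ h0, hne _ h1, h2, if_false]
    -- With no intermediate vertex in `U`, an end lying in `A` would pull all of them into `A` along
    -- the cycle. So both ends lie in `U` and reveal both bits.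
    have hU0 : f 0 ∈ U := by
      refine h0.resolve_right fun h => hA' ?_
      have : ∀ j, j < n → f j ∈ A := by
        intro j
        induction j with
        | zero => exact fun _ => h
        | succ j ih =>
          exact fun hj => hA _ (ih (by omega)) _ (hmid _ (by omega) hj) (hadj j (by omega))
      exact fun j _ => this j
    have hUn : f n ∈ U := by
      refine h1.resolve_right fun h => hA' ?_
      have : ∀ j, j < n → f (n - j) ∈ A := by
        intro j
        induction j with
        | zero => exact fun _ => h
        | succ j ih =>
          intro hj
          refine hA _ (ih (by omega)) _ (hmid _ (by omega) (by omega)) ?_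
          have := hadj (n - (j + 1)) (by omega)
          rw [show n - (j + 1) + 1 = n - j by omega] at this
          exact this.symm
      intro j j0 jn
      have := this (n - j) (by omega)
      rwa [Nat.sub_sub_self jn.le] at this
    have hω : ω = ω' := by
      have h2 := hU _ hU0
      have h3 := hU _ hUn
      simp only [g0, gn, ULift.up.injEq, Prod.mk.injEq, and_true] at h2 h3
      exact Prod.ext h2 h3
    rw [hω]

end Xor

end MRF

theorem mainTheorem3 {V : Type*} [Fintype V] [DecidableEq V] (G : SimpleGraph V)
    (hG : 2 ≤ Nat.card G.ConnectedComponent) :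
    (∀ (𝒳 : V → Type*) (p : PMF (∀ i, 𝒳 i)),
        (∀ i, MRF.FiniteEntropy (p.map fun x => x i)) → MRF.IsMRF G p → 0 ≤ MRF.iMeasure p) ↔
      MRF.IsForestOfPaths G := by
  refine ⟨fun h => ⟨hG, fun C => ?_⟩, fun h _ _ hp hM => h.iMeasure_nonneg hp hM⟩
  -- The `ULift` in `bitsLaw` places the two-bit alphabets in whatever universe `𝒳` ranges over.
  have hneg : ¬ ∃ g : V → Bool × Bool → Bool × Bool, MRF.IsMRF G (MRF.bitsLaw g) ∧
      ¬ 0 ≤ MRF.iMeasure (MRF.bitsLaw g) := fun ⟨g, hM, hn⟩ =>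
    hn (h _ _ (MRF.finiteEntropy_bitsLaw g) hM)
  rcases MRF.isPathGraph_or_star_or_cycle C.connected_toSimpleGraph with
    h | ⟨c, a, b, d, hca, hcb, hcd, hab, had, hbd⟩ | ⟨n, f, hn, hinj, hadj, hclose⟩
  · exact h
  · exact absurd (MRF.exists_isMRF_of_star (C.toSimpleGraph_hom.map_adj hca)
      (C.toSimpleGraph_hom.map_adj hcb) (C.toSimpleGraph_hom.map_adj hcd)
      (Subtype.coe_ne_coe.2 hab) (Subtype.coe_ne_coe.2 had) (Subtype.coe_ne_coe.2 hbd)) hneg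
  · exact absurd (MRF.exists_isMRF_of_cycle (f := fun i => (f i : V)) hn
      (fun i hi j hj e => hinj i hi j hj (Subtype.ext e))
      (fun i hi => C.toSimpleGraph_hom.map_adj (hadj i hi))
      (C.toSimpleGraph_hom.map_adj hclose)) hneg
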